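/- Let $k$ be a field that is complete with respect to a non-trivial discrete non-Archimedean absolute value, with residue field $\widetilde{k}$, and let $k'/k$ be a finite Galois extension, endowed with the unique absolute value extending that of $k$. Assume that $k'/k$ is totally ramified, i.e. that $[|k'^{\times}| : |k^{\times}|] = [k':k]$. For $K \in \{k, k'\}$, let $\mathcal{B}(\mathrm{SL}_2, K)$ be the Bruhat--Tits building of $\mathrm{SL}_2$ over $K$, realized as the set of homothety classes of diagonalizable norms on $K^2$, i.e. of norms of the form $\lambda_0 e_0 + \lambda_1 e_1 \mapsto \max(\exp(c_0)|\lambda_0|, \exp(c_1)|\lambda_1|)$ for some basis $(e_0,e_1)$ of $K^2$ and some $c_0, c_1 \in \mathbf{R}$. The group $\mathrm{Gal}(k'/k)$ acts on $\mathcal{B}(\mathrm{SL}_2,k')$ by $\sigma\cdot[N] = [N \circ \sigma^{-1}]$, where $\sigma^{-1}$ acts coordinatewise on $k'^2$, and there is a natural map $\mathcal{B}(\mathrm{SL}_2,k) \to \mathcal{B}(\mathrm{SL}_2,k')$, $[N] \mapsto [N_{k'}]$, given by extension of scalars of norms: $N_{k'}(w) = \inf \max_i |a_i| N(x_i)$,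 the infimum being taken over all finite expressions $w = \sum_i a_i x_i$ with $a_i \in k'$ and $x_i \in k^2$. Then this natural map is injective and its image is contained in the set $\mathcal{B}(\mathrm{SL}_2,k')^{\mathrm{Gal}(k'/k)}$ of Galois-fixed points. Identifying $\mathcal{B}(\mathrm{SL}_2,k)$ with its image, $$\mathcal{B}(\mathrm{SL}_2,k) \subsetneq \mathcal{B}(\mathrm{SL}_2,k')^{\mathrm{Gal}(k'/k)} \iff [k':k] \text{ is divisible by the characteristic of } \widetilde{k}$$ (if $\widetilde{k}$ has characteristic $0$, the right-hand side is false). -/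

import Mathlib

namespace GoldmanIwahori

noncomputable section

open Module
open scoped Pointwise

section Norms

variable {n : ℕ} {K : Type*} [NormedField K]

/-- The function `∑ i, λ i • b i ↦ max_i exp (c i) * |λ i|` attached to a basis `b` of `K ^ n`
and to `c ∈ ℝ ^ n`. -/
def diagFun (b : Basis (Fin n) K (Fin n → K)) (c : Fin n → ℝ) (v : Fin n → K) : ℝ :=
  ⨆ i, Real.exp (c i) * ‖b.repr v i‖

theorem le_diagFun (b : Basis (Fin n) K (Fin n → K)) (c : Fin n → ℝ) (v : Fin n → K)
    (i : Fin n) : Real.exp (c i) * ‖b.repr v i‖ ≤ diagFun b c v :=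
  le_ciSup (f := fun i => Real.exp (c i) * ‖b.repr v i‖) (Set.finite_range _).bddAbove i

theorem diagFun_nonneg (b : Basis (Fin n) K (Fin n → K)) (c : Fin n → ℝ) (v : Fin n → K) :
    0 ≤ diagFun b c v :=
  Real.iSup_nonneg fun i => by positivity

theorem diagFun_le {b : Basis (Fin n) K (Fin n → K)} {c : Fin n → ℝ} {v : Fin n → K} {r : ℝ}
    (hr : 0 ≤ r) (h : ∀ i, Real.exp (c i) * ‖b.repr v i‖ ≤ r) : diagFun b c v ≤ r :=
  Real.iSup_le h hr

theorem diagFun_smul (b : Basis (Fin n) K (Fin n → K)) (c : Fin n → ℝ) (a : K)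
    (v : Fin n → K) : diagFun b c (a • v) = ‖a‖ * diagFun b c v := by
  unfold diagFun
  rw [Real.mul_iSup_of_nonneg (norm_nonneg a)]
  congr 1
  ext i
  simp only [map_smul, Finsupp.smul_apply, smul_eq_mul, norm_mul]
  ring

theorem diagFun_basis (b : Basis (Fin n) K (Fin n → K)) (c : Fin n → ℝ) (i : Fin n) :
    diagFun b c (b i) = Real.exp (c i) := by
  apply le_antisymm
  · refine diagFun_le (Real.exp_pos _).le fun j => ?_
    by_cases h : i = j
    · subst h; simp
    · simp [h, (Real.exp_pos (c i)).le]
  · simpa using le_diagFun b c (b i) i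

/-- The norm on `K ^ n` diagonalized by the basis `b` with parameters `c`. -/
def diagSeminorm [IsUltrametricDist K] (b : Basis (Fin n) K (Fin n → K)) (c : Fin n → ℝ) :
    Seminorm K (Fin n → K) :=
  Seminorm.of (diagFun b c)
    (fun v w => by
      refine diagFun_le (add_nonneg (diagFun_nonneg b c v) (diagFun_nonneg b c w)) fun i => ?_
      calc Real.exp (c i) * ‖b.repr (v + w) i‖
          ≤ Real.exp (c i) * (‖b.repr v i‖ + ‖b.repr w i‖) := by
            gcongr
            simpa using norm_add_le (b.repr v i) (b.repr w i)
        _ ≤ diagFun b c v + diagFun b c w := by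
            rw [mul_add]
            exact add_le_add (le_diagFun b c v i) (le_diagFun b c w i))
    (diagFun_smul b c)

/-- `N` is diagonalizable: some basis of `K ^ n` is adapted to it. Over a non-Archimedean field
such an `N` is automatically a non-Archimedean norm, i.e. it is ultrametric and it vanishes only
at the origin (see `IsDiagonalizable.add_le_max` and `IsDiagonalizable.eq_zero`). -/
def IsDiagonalizable (N : Seminorm K (Fin n → K)) : Prop :=
  ∃ (b : Basis (Fin n) K (Fin n → K)) (c : Fin n → ℝ), ∀ v, N v = diagFun b c v

theorem IsDiagonalizable.add_le_max [IsUltrametricDist K] {N : Seminorm K (Fin n → K)}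
    (hN : IsDiagonalizable N) (v w : Fin n → K) : N (v + w) ≤ max (N v) (N w) := by
  obtain ⟨b, c, h⟩ := hN
  simp only [h]
  refine diagFun_le (le_max_of_le_left (diagFun_nonneg b c v)) fun i => ?_
  have h1 : ‖b.repr (v + w) i‖ ≤ max ‖b.repr v i‖ ‖b.repr w i‖ := by
    simpa using IsUltrametricDist.norm_add_le_max (b.repr v i) (b.repr w i)
  rcases le_max_iff.1 h1 with h2 | h2
  · exact le_max_of_le_left
      ((mul_le_mul_of_nonneg_left h2 (Real.exp_pos _).le).trans (le_diagFun b c v i))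
  · exact le_max_of_le_right
      ((mul_le_mul_of_nonneg_left h2 (Real.exp_pos _).le).trans (le_diagFun b c w i))

theorem IsDiagonalizable.eq_zero {N : Seminorm K (Fin n → K)}
    (hN : IsDiagonalizable N) {v : Fin n → K} (hv : N v = 0) : v = 0 := by
  obtain ⟨b, c, h⟩ := hN
  rw [h] at hv
  apply b.repr.injective
  ext i
  have h1 := le_diagFun b c v i
  rw [hv] at h1
  have h2 : ‖b.repr v i‖ ≤ 0 := by
    by_contra h3
    exact absurd h1 (not_le.2 (mul_pos (Real.exp_pos _) (not_le.1 h3)))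
  simpa using h2

variable (n K) in
/-- The space of diagonalizable norms on `K ^ n`. -/
def DiagNorms : Type _ := {N : Seminorm K (Fin n → K) // IsDiagonalizable N}

variable (n K) in
/-- Homothety: `N ∼ N'` if `N = a * N'` for some real number `a > 0`. -/
def homothety : Setoid (DiagNorms n K) where
  r N N' := ∃ a : ℝ, 0 < a ∧ ∀ v, N.1 v = a * N'.1 v
  iseqv :=
    { refl := fun N => ⟨1, one_pos, fun v => (one_mul _).symm⟩
      symm := by
        rintro N N' ⟨a, ha, h⟩
        exact ⟨a⁻¹, inv_pos.2 ha, fun v => by rw [h, inv_mul_cancel_left₀ ha.ne']⟩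
      trans := by
        rintro N N' N'' ⟨a, ha, h⟩ ⟨a', ha', h'⟩
        exact ⟨a * a', mul_pos ha ha', fun v => by rw [h, h', mul_assoc]⟩ }

variable (n K) in
/-- The Bruhat-Tits building `B(SL_n, K)`: homothety classes of diagonalizable norms
on `K ^ n`. -/
def Building : Type _ := Quotient (homothety n K)

end Norms

section BaseChange

variable {n : ℕ} {k k' : Type*} [NormedField k] [NormedField k'] [NormedAlgebra k k']

/-- The basis of `k' ^ n` given by the vectors of a basis of `k ^ n`. -/
def extendBasis (k' : Type*) [NormedField k'] [NormedAlgebra k k']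
    (b : Basis (Fin n) k (Fin n → k)) : Basis (Fin n) k' (Fin n → k') :=
  (Algebra.TensorProduct.basis k' b).map (TensorProduct.piScalarRight k k' k' (Fin n))

theorem extendBasis_apply (b : Basis (Fin n) k (Fin n → k)) (i : Fin n) :
    extendBasis k' b i = fun j => algebraMap k k' (b i j) := by
  ext j
  simp [extendBasis, Algebra.algebraMap_eq_smul_one]

theorem extendBasis_repr (b : Basis (Fin n) k (Fin n → k)) (x : Fin n → k) (i : Fin n) :
    (extendBasis k' b).repr (fun j => algebraMap k k' (x j)) i = algebraMap k k' (b.repr x i) := by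
  have h : (fun j => algebraMap k k' (x j)) =
      ∑ l, algebraMap k k' (b.repr x l) • extendBasis k' b l := by
    ext j
    conv_lhs => rw [← b.sum_repr x]
    simp [extendBasis_apply, Finset.sum_apply, Algebra.smul_def]
  rw [h, Basis.repr_sum_self]

/-- The values `max_i |a i| * N (x i)` for all expressions `w = ∑ i, a i • x i` of a vector `w`
of `k' ^ n` with `a i ∈ k'` and `x i ∈ k ^ n`. -/
def tensorValues (N : Seminorm k (Fin n → k)) (w : Fin n → k') : Set ℝ :=
  {r | ∃ (m : ℕ) (a : Fin m → k') (x : Fin m → Fin n → k),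
    w = ∑ i, a i • (fun j => algebraMap k k' (x i j)) ∧ r = ⨆ i, ‖a i‖ * N (x i)}

/-- The extension of scalars `N ⊗ 1` of a norm `N` on `k ^ n` to `k' ^ n`. -/
def tensorFun (N : Seminorm k (Fin n → k)) (w : Fin n → k') : ℝ := sInf (tensorValues N w)

theorem tensorFun_eq [IsUltrametricDist k'] {N : Seminorm k (Fin n → k)}
    {b : Basis (Fin n) k (Fin n → k)} {c : Fin n → ℝ} (h : ∀ v, N v = diagFun b c v)
    (w : Fin n → k') : tensorFun N w = diagFun (extendBasis k' b) c w := by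
  apply IsLeast.csInf_eq
  constructor
  · refine ⟨n, fun i => (extendBasis k' b).repr w i, fun i => b i, ?_, ?_⟩
    · conv_lhs => rw [← (extendBasis k' b).sum_repr w]
      simp only [extendBasis_apply]
    · simp only [h, diagFun_basis]
      unfold diagFun
      simp only [mul_comm]
  · rintro r ⟨m, a, x, rfl, rfl⟩
    have hnn : 0 ≤ ⨆ i, ‖a i‖ * N (x i) :=
      Real.iSup_nonneg fun i => mul_nonneg (norm_nonneg _) (apply_nonneg _ _)
    refine diagFun_le hnn fun i => ?_
    rw [← le_div_iff₀' (Real.exp_pos _)]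
    simp only [map_sum, map_smul, Finsupp.finsetSum_apply, Finsupp.smul_apply, extendBasis_repr,
      smul_eq_mul]
    refine IsUltrametricDist.norm_sum_le_of_forall_le_of_nonneg
      (div_nonneg hnn (Real.exp_pos _).le) fun l _ => ?_
    rw [le_div_iff₀' (Real.exp_pos _), norm_mul, norm_algebraMap']
    calc Real.exp (c i) * (‖a l‖ * ‖b.repr (x l) i‖)
        = ‖a l‖ * (Real.exp (c i) * ‖b.repr (x l) i‖) := by ring
      _ ≤ ‖a l‖ * N (x l) := by
          rw [h]
          exact mul_le_mul_of_nonneg_left (le_diagFun b c (x l) i) (norm_nonneg _)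
      _ ≤ ⨆ l, ‖a l‖ * N (x l) :=
          le_ciSup (f := fun l => ‖a l‖ * N (x l)) (Set.finite_range _).bddAbove l

/-- Extension of scalars of diagonalizable norms. -/
def DiagNorms.baseChange (k' : Type*) [NormedField k'] [NormedAlgebra k k']
    [IsUltrametricDist k'] (N : DiagNorms n k) : DiagNorms n k' :=
  ⟨Seminorm.of (tensorFun N.1)
    (by
      obtain ⟨b, c, h⟩ := N.2
      intro v w
      simp only [tensorFun_eq h]
      exact map_add_le_add (diagSeminorm (extendBasis k' b) c) v w)
    (by
      obtain ⟨b, c, h⟩ := N.2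
      intro a w
      simp only [tensorFun_eq h]
      exact diagFun_smul _ _ _ _),
    by
      obtain ⟨b, c, h⟩ := N.2
      exact ⟨extendBasis k' b, c, fun w => tensorFun_eq h w⟩⟩

theorem tensorFun_homothety {N N' : Seminorm k (Fin n → k)} {a : ℝ} (ha : 0 < a)
    (h : ∀ v, N v = a * N' v) (w : Fin n → k') : tensorFun N w = a * tensorFun N' w := by
  have hs : tensorValues N w = a • tensorValues N' w := by
    ext r
    simp only [tensorValues, Set.mem_smul_set, Set.mem_ofPred_eq, smul_eq_mul]
    constructor
    · rintro ⟨m, t, x, hw, rfl⟩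
      refine ⟨_, ⟨m, t, x, hw, rfl⟩, ?_⟩
      rw [Real.mul_iSup_of_nonneg ha.le]
      simp only [h, mul_left_comm]
    · rintro ⟨_, ⟨m, t, x, hw, rfl⟩, rfl⟩
      refine ⟨m, t, x, hw, ?_⟩
      rw [Real.mul_iSup_of_nonneg ha.le]
      simp only [h, mul_left_comm]
  rw [tensorFun, tensorFun, hs, Real.sInf_smul_of_nonneg ha.le, smul_eq_mul]

/-- The natural map `B(SL_n, k) → B(SL_n, k')` given by functoriality of the building. -/
def Building.baseChange (n : ℕ) (k k' : Type*) [NormedField k] [NormedField k']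
    [NormedAlgebra k k'] [IsUltrametricDist k'] : Building n k → Building n k' :=
  Quotient.map (sa := homothety n k) (sb := homothety n k') (DiagNorms.baseChange k')
    fun _ _ ⟨a, ha, h⟩ => ⟨a, ha, tensorFun_homothety ha h⟩

end BaseChange

section Galois

variable {n : ℕ} {k k' : Type*} [NontriviallyNormedField k] [CompleteSpace k]
  [IsUltrametricDist k] [NormedField k'] [NormedAlgebra k k'] [Algebra.IsAlgebraic k k']

theorem norm_galois (σ : k' ≃ₐ[k] k') (x : k') : ‖σ x‖ = ‖x‖ := by
  rw [NormedAlgebra.norm_eq_spectralNorm k, NormedAlgebra.norm_eq_spectralNorm k]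
  exact (spectralNorm_eq_of_equiv σ x).symm

/-- The transform of a basis of `k' ^ n` by a Galois automorphism acting on coordinates. -/
def conjBasis (σ : k' ≃ₐ[k] k') (b : Basis (Fin n) k' (Fin n → k')) :
    Basis (Fin n) k' (Fin n → k') :=
  Basis.ofEquivFun
    { toFun := fun v i => σ (b.repr (fun j => σ.symm (v j)) i)
      invFun := fun a j => σ (b.equivFun.symm (fun i => σ.symm (a i)) j)
      map_add' := fun v w => by
        ext i
        have : (fun j => σ.symm ((v + w) j)) =
            (fun j => σ.symm (v j)) + fun j => σ.symm (w j) := by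
          ext j; simp
        rw [this]; simp
      map_smul' := fun a v => by
        ext i
        have : (fun j => σ.symm ((a • v) j)) = σ.symm a • fun j => σ.symm (v j) := by
          ext j; simp
        rw [this]; simp
      left_inv := fun v => by
        ext j
        have : (fun i => σ.symm (σ (b.repr (fun j => σ.symm (v j)) i))) =
            b.equivFun (fun j => σ.symm (v j)) := by
          ext i; simp
        simp only [this, LinearEquiv.symm_apply_apply, AlgEquiv.apply_symm_apply]
      right_inv := fun a => by
        ext i
        simp only [AlgEquiv.symm_apply_apply]
        have : b.repr (b.equivFun.symm fun i => σ.symm (a i)) i = σ.symm (a i) := by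
          rw [← Basis.equivFun_apply, LinearEquiv.apply_symm_apply]
        exact (congrArg σ this).trans (σ.apply_symm_apply _) }

theorem conjBasis_repr (σ : k' ≃ₐ[k] k') (b : Basis (Fin n) k' (Fin n → k'))
    (v : Fin n → k') (i : Fin n) :
    (conjBasis σ b).repr v i = σ (b.repr (fun j => σ.symm (v j)) i) := by
  rw [← Basis.equivFun_apply, conjBasis, Basis.equivFun_ofEquivFun]
  rfl

/-- The Galois action on norms on `k' ^ n`: `(σ N) v = N (σ⁻¹ v)`, where `σ⁻¹` acts on `k' ^ n`
coordinatewise. -/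
def DiagNorms.galois (σ : k' ≃ₐ[k] k') (N : DiagNorms n k') : DiagNorms n k' :=
  ⟨Seminorm.of (fun v => N.1 (fun j => σ.symm (v j)))
    (fun v w => by
      have : (fun j => σ.symm ((v + w) j)) =
          (fun j => σ.symm (v j)) + fun j => σ.symm (w j) := by
        ext j; simp
      rw [this]
      exact map_add_le_add N.1 _ _)
    (fun a v => by
      have : (fun j => σ.symm ((a • v) j)) = σ.symm a • fun j => σ.symm (v j) := by
        ext j; simp
      rw [this, map_smul_eq_mul, norm_galois]),
    by
      obtain ⟨b, c, h⟩ := N.2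
      refine ⟨conjBasis σ b, c, fun v => ?_⟩
      simp only [diagFun, conjBasis_repr, norm_galois]
      exact h _⟩

/-- The action of `Gal(k'/k)` on the building `B(SL_n, k')`. -/
instance Building.galoisAction : MulAction (k' ≃ₐ[k] k') (Building n k') where
  smul σ := Quotient.map (sa := homothety n k') (sb := homothety n k') (DiagNorms.galois σ)
    fun _ _ ⟨a, ha, h⟩ => ⟨a, ha, fun _ => h _⟩
  one_smul x := by
    induction x using Quotient.inductionOn
    rfl
  mul_smul σ τ x := by
    induction x using Quotient.inductionOn
    rfl

end Galois

section Valuations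

/-- The group of values `|K ^ ×|`. -/
def valueGroup (K : Type*) [NormedField K] : Subgroup ℝˣ :=
  (Units.map (normHom : K →*₀ ℝ).toMonoidHom).range

/-- The absolute value of `K` is discrete and non-trivial: `|K ^ ×|` is infinite cyclic,
generated by the absolute value of an element `π`. -/
def IsDiscretelyValued (K : Type*) [NormedField K] : Prop :=
  ∃ π : K, 0 < ‖π‖ ∧ ‖π‖ < 1 ∧ ∀ x : K, x ≠ 0 → ∃ m : ℤ, ‖x‖ = ‖π‖ ^ m

/-- The extension `k'/k` is totally ramified: its ramification index, which is the index of
`|k ^ ×|` in `|k' ^ ×|`, is equal to its (finite) degree. -/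
def IsTotallyRamified (k k' : Type*) [NormedField k] [NormedField k'] [NormedAlgebra k k'] :
    Prop :=
  (valueGroup k).relIndex (valueGroup k') = finrank k k'

/-- The characteristic of the residue field of a non-Archimedean field. -/
def residueChar (K : Type*) [NormedField K] [IsUltrametricDist K] : ℕ :=
  ringChar (IsLocalRing.ResidueField (NormedField.valuation (K := K)).valuationSubring)

end Valuations

end

end GoldmanIwahori

/-!
A seminorm on `K ^ n` is diagonalizable as soon as every line has an orthogonal complement cut out
by a norming functional. Such functionals survive restriction from `k' ^ n` to `k ^ n` if there is a
norm-decreasing retraction of `k'` onto `k`, and if the residue characteristic does not divide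
`[k' : k]` the normalized trace is one. Total ramification provides a basis `B` of `k'` over `k`
with values in distinct classes modulo `|k ^ ×|`. Given a Galois-invariant norm `N` on `k' ^ n`, the
trace isolates the dominant term of `w = ∑ i, B i • x i`, so `N w = max_i ‖B i‖ * N (x i)` and `N`
is the extension of scalars of its restriction.

If the residue characteristic `p` divides `[k' : k]`, some `x ∈ k' ^ ×` has a value of order `p`
modulo `|k ^ ×|`. Then each `σ x / x` has a `p`-th power congruent to `1`, hence is itself congruent
to `1`, and one can choose `r` with `‖σ x - x‖ ≤ r < ‖x‖` for all `σ`. The norm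
`max (‖v 0 - x * v 1‖, r * ‖v 1‖)` on `k' ^ 2` is Galois-invariant. On `k ^ 2` it is at least
`‖x * v 1‖`, since `‖x‖` is not a value of `k`; were it an extension of scalars, it would be at
least `‖x * v 1‖` on `k' ^ 2`, which fails at `(x, 1)`.
-/

namespace GoldmanIwahori

open Module

section Orthogonality

variable {K V W ι : Type*} [NormedField K] [AddCommGroup V] [Module K V] [AddCommGroup W]
  [Module K W] {N : Seminorm K V}

theorem apply_sum_le_of_forall_le (hN : IsNonarchimedean N) {s : Finset ι} {f : ι → V} {r : ℝ}
    (hr : 0 ≤ r) (h : ∀ i ∈ s, N (f i) ≤ r) : N (∑ i ∈ s, f i) ≤ r :=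
  Finset.sum_induction f (N · ≤ r) (fun v w hv hw => (hN v w).trans (max_le hv hw))
    (by simpa using hr) h

theorem apply_sum_lt_of_forall_lt (hN : IsNonarchimedean N) {s : Finset ι} {f : ι → V} {r : ℝ}
    (hr : 0 < r) (h : ∀ i ∈ s, N (f i) < r) : N (∑ i ∈ s, f i) < r :=
  Finset.sum_induction f (N · < r) (fun v w hv hw => (hN v w).trans_lt (max_lt hv hw))
    (by simpa using hr) h

/-- A family of vectors is orthogonal for `N` if no cancellation occurs in its linear combinations:
for a non-Archimedean `N` this says `N (∑ j, a j • v j) = max_j ‖a j‖ * N (v j)`. -/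
def IsOrthogonal [Fintype ι] (N : Seminorm K V) (v : ι → V) : Prop :=
  ∀ (a : ι → K) (i : ι), ‖a i‖ * N (v i) ≤ N (∑ j, a j • v j)

/-- The values of `N` at the vectors of the family lie in pairwise distinct classes modulo the
value group of `K`. -/
def HasDistinctValues (N : Seminorm K V) (v : ι → V) : Prop :=
  Pairwise fun i j => ∀ c : K, N (v i) ≠ ‖c‖ * N (v j)

theorem HasDistinctValues.isOrthogonal [Fintype ι] {v : ι → V} (hv : HasDistinctValues N v)
    (hN : IsNonarchimedean N) : IsOrthogonal N v := by
  intro a i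
  have : Nonempty ι := ⟨i⟩
  obtain ⟨l, hl⟩ := Finite.exists_max fun j => N (a j • v j)
  rw [← map_smul_eq_mul]
  refine (hl i).trans ?_
  by_cases hal : a l = 0
  · simp [hal]
  · have hlt (j : ι) (hj : j ≠ l) : N (a j • v j) < N (a l • v l) := by
      refine (hl j).lt_of_ne fun heq => hv hj.symm ((a l)⁻¹ * a j) ?_
      rw [map_smul_eq_mul, map_smul_eq_mul] at heq
      rw [norm_mul, norm_inv, mul_assoc, heq, inv_mul_cancel_left₀ (norm_ne_zero_iff.2 hal)]
    exact (hN.apply_sum_eq_of_lt (fun w => (map_neg_eq_map N w).symm) (Finset.mem_univ l)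
      fun j _ => hlt j).ge

theorem IsOrthogonal.linearIndependent [Fintype ι] {v : ι → V} (hv : IsOrthogonal N v)
    (h0 : ∀ i, N (v i) ≠ 0) : LinearIndependent K v := by
  refine Fintype.linearIndependent_iff.2 fun a ha i => ?_
  have hle : ‖a i‖ * N (v i) ≤ 0 := by simpa only [ha, map_zero] using hv a i
  have hmul : ‖a i‖ * N (v i) = 0 := hle.antisymm (by positivity)
  exact norm_eq_zero.1 ((mul_eq_zero.1 hmul).resolve_right (h0 i))

theorem IsOrthogonal.finCons {n : ℕ} {u : Fin n → V} (hu : IsOrthogonal N u)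
    (hN : IsNonarchimedean N) {φ : Dual K V} {w : V} (hφw : φ w = 1)
    (hφ : ∀ v, ‖φ v‖ * N w ≤ N v) (hφu : ∀ i, φ (u i) = 0) :
    IsOrthogonal N (Fin.cons w u : Fin (n + 1) → V) := by
  intro a
  simp only [Fin.sum_univ_succ, Fin.cons_zero, Fin.cons_succ]
  set t := ∑ j, a (Fin.succ j) • u j with ht
  have hφt : φ (a 0 • w + t) = a 0 := by simp [ht, hφu, hφw]
  have hw : ‖a 0‖ * N w ≤ N (a 0 • w + t) := by simpa only [hφt] using hφ (a 0 • w + t)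
  refine Fin.cases hw fun i => ?_
  calc ‖a i.succ‖ * N (u i) ≤ N t := hu (fun j => a j.succ) i
    _ = N (a 0 • w + t + -(a 0 • w)) := by rw [add_neg_cancel_comm]
    _ ≤ max (N (a 0 • w + t)) (N (-(a 0 • w))) := hN _ _
    _ ≤ N (a 0 • w + t) := by
      rw [map_neg_eq_map, map_smul_eq_mul]
      exact max_le le_rfl hw

/-- Every line has an `N`-orthogonal complement, namely the kernel of a functional `φ` for which
the projection `v ↦ φ v • w` onto the line does not increase `N`. -/
def HasNormingFunctionals (N : Seminorm K V) : Prop :=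
  ∀ w ≠ 0, ∃ φ : Dual K V, φ w = 1 ∧ ∀ v, ‖φ v‖ * N w ≤ N v

theorem HasNormingFunctionals.comp (h : HasNormingFunctionals N) {f : W →ₗ[K] V}
    (hf : Function.Injective f) : HasNormingFunctionals (N.comp f) := by
  intro w hw
  obtain ⟨φ, hφw, hφ⟩ := h (f w) ((map_ne_zero_iff f hf).2 hw)
  exact ⟨φ ∘ₗ f, hφw, fun v => hφ (f v)⟩

theorem HasNormingFunctionals.exists_basis_isOrthogonal [FiniteDimensional K V] {n : ℕ}
    (h : HasNormingFunctionals N) (hN : IsNonarchimedean N) (hn : finrank K V = n) :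
    ∃ b : Basis (Fin n) K V, IsOrthogonal N b := by
  induction n generalizing V with
  | zero => exact ⟨finBasisOfFinrankEq K V hn, fun _ i => i.elim0⟩
  | succ n ih =>
    have : Nontrivial V := nontrivial_of_finrank_eq_succ hn
    obtain ⟨w, hw⟩ := exists_ne (0 : V)
    obtain ⟨φ, hφw, hφ⟩ := h w hw
    have hφ0 : φ ≠ 0 := by
      rintro rfl
      simp at hφw
    have hker := Dual.finrank_ker_add_one_of_ne_zero hφ0
    obtain ⟨u, hu⟩ := ih (h.comp φ.ker.injective_subtype) (fun v v' => hN v v') (by omega)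
    have hdisjoint (c : K) (x : V) (hx : x ∈ φ.ker) (hcx : c • w + x = 0) : c = 0 := by
      simpa [LinearMap.mem_ker.1 hx, hφw] using congrArg φ hcx
    have hspan (z : V) : ∃ c : K, z + c • w ∈ φ.ker := ⟨-φ z, by simp [hφw]⟩
    refine ⟨u.mkFinCons w hdisjoint hspan, ?_⟩
    rw [Basis.coe_mkFinCons]
    refine IsOrthogonal.finCons (fun a i => ?_) hN hφw hφ fun i => (u i).2
    simpa using hu a i

end Orthogonality

section Diagonalizable

variable {n : ℕ} {K : Type*} [NormedField K] {N : Seminorm K (Fin n → K)}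

theorem IsOrthogonal.isDiagonalizable {b : Basis (Fin n) K (Fin n → K)} (hb : IsOrthogonal N b)
    (hN : IsNonarchimedean N) (h0 : ∀ v, N v = 0 → v = 0) : IsDiagonalizable N := by
  have hpos (i : Fin n) : 0 < N (b i) :=
    (apply_nonneg N _).lt_of_ne fun h => b.ne_zero i (h0 _ h.symm)
  refine ⟨b, fun i => Real.log (N (b i)), fun v => le_antisymm ?_ ?_⟩
  · conv_lhs => rw [← b.sum_repr v]
    refine apply_sum_le_of_forall_le hN (diagFun_nonneg _ _ _) fun i _ => ?_
    rw [map_smul_eq_mul, mul_comm]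
    simpa only [Real.exp_log (hpos i)] using le_diagFun b (fun i => Real.log (N (b i))) v i
  · refine diagFun_le (apply_nonneg N v) fun i => ?_
    rw [Real.exp_log (hpos i), mul_comm]
    simpa only [b.sum_repr] using hb (b.repr v) i

theorem IsDiagonalizable.hasNormingFunctionals (hN : IsDiagonalizable N) :
    HasNormingFunctionals N := by
  obtain ⟨b, c, h⟩ := hN
  intro w hw
  obtain ⟨j, hj⟩ : ∃ j, b.repr w j ≠ 0 := by
    by_contra! hzero
    exact hw (b.repr.map_eq_zero_iff.1 (Finsupp.ext hzero))
  have : Nonempty (Fin n) := ⟨j⟩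
  obtain ⟨i, hi⟩ := Finite.exists_max fun i => Real.exp (c i) * ‖b.repr w i‖
  have hNw : N w = Real.exp (c i) * ‖b.repr w i‖ :=
    (h w).trans (le_antisymm (diagFun_le (by positivity) hi) (le_diagFun b c w i))
  have hwi : b.repr w i ≠ 0 := by
    have : 0 < Real.exp (c j) * ‖b.repr w j‖ := by positivity
    exact norm_pos_iff.1 (pos_of_mul_pos_right (this.trans_le (hi j)) (Real.exp_pos _).le)
  refine ⟨(b.repr w i)⁻¹ • b.coord i, by simp [hwi], fun v => ?_⟩
  calc ‖((b.repr w i)⁻¹ • b.coord i) v‖ * N w = Real.exp (c i) * ‖b.repr v i‖ := by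
        rw [hNw, LinearMap.smul_apply, Basis.coord_apply, norm_smul, norm_inv]
        field_simp
    _ ≤ N v := (le_diagFun b c v i).trans (h v).ge

end Diagonalizable

section ResidueChar

variable {K : Type*} [NormedField K] [IsUltrametricDist K]

theorem residue_eq_zero_iff_norm_lt_one (x : (NormedField.valuation (K := K)).valuationSubring) :
    IsLocalRing.residue _ x = 0 ↔ ‖(x : K)‖ < 1 := by
  rw [IsLocalRing.residue_eq_zero_iff, Valuation.mem_maximalIdeal_iff]
  rfl

variable (K) in
theorem residueChar_dvd_iff (m : ℕ) : residueChar K ∣ m ↔ ‖(m : K)‖ < 1 := by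
  rw [residueChar, ← ringChar.spec, ← map_natCast (IsLocalRing.residue _),
    residue_eq_zero_iff_norm_lt_one]
  rfl

theorem residueChar_eq (k k' : Type*) [NormedField k] [NormedField k'] [NormedAlgebra k k']
    [IsUltrametricDist k] [IsUltrametricDist k'] : residueChar k' = residueChar k := by
  have hdvd (m : ℕ) : residueChar k' ∣ m ↔ residueChar k ∣ m := by
    rw [residueChar_dvd_iff, residueChar_dvd_iff, ← norm_algebraMap' k' (m : k), map_natCast]
  exact Nat.dvd_antisymm ((hdvd _).2 dvd_rfl) ((hdvd _).1 dvd_rfl)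

theorem norm_natCast_eq_one {m : ℕ} (h : ¬ residueChar K ∣ m) : ‖(m : K)‖ = 1 :=
  (IsUltrametricDist.norm_natCast_le_one K m).antisymm
    (not_lt.1 fun hlt => h ((residueChar_dvd_iff K m).2 hlt))

theorem residueChar_prime {m : ℕ} (hm : m ≠ 0) (h : residueChar K ∣ m) :
    (residueChar K).Prime :=
  (CharP.char_is_prime_or_zero (IsLocalRing.ResidueField
    (NormedField.valuation (K := K)).valuationSubring) (residueChar K)
    (hc := ringChar.charP _)).resolve_right fun h0 => hm (zero_dvd_iff.1 (h0 ▸ h))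

theorem norm_sub_one_lt_one_of_pow {p : ℕ} (hp : p.Prime) (hpK : residueChar K = p) {u : K}
    (h : ‖u ^ p - 1‖ < 1) : ‖u - 1‖ < 1 := by
  have hu : ‖u‖ ≤ 1 := by
    rw [← pow_le_one_iff_of_nonneg (norm_nonneg u) hp.ne_zero, ← norm_pow]
    simpa [h.le] using IsUltrametricDist.norm_add_le_max (u ^ p - 1) 1
  let R := (NormedField.valuation (K := K)).valuationSubring
  have : Fact p.Prime := ⟨hp⟩
  have : CharP (IsLocalRing.ResidueField R) p := hpK ▸ ringChar.charP _
  let v : R := ⟨u, hu⟩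
  have hvp : IsLocalRing.residue R (v ^ p - 1) = 0 := (residue_eq_zero_iff_norm_lt_one _).2 h
  refine (residue_eq_zero_iff_norm_lt_one (v - 1)).1 (eq_zero_of_pow_eq_zero (n := p) ?_)
  rwa [map_sub, map_one, sub_pow_char, one_pow, ← map_pow, ← map_one (IsLocalRing.residue R),
    ← map_sub]

end ResidueChar

section Ramification

variable (k k' : Type*) [NormedField k] [NormedField k']

/-- The quotient `|k' ^ ×| / |k ^ ×|` of the value groups, whose order is the ramification index
of `k'/k`. -/
abbrev ValueQuotient : Type :=
  valueGroup k' ⧸ (valueGroup k).subgroupOf (valueGroup k')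

/-- The class of `‖x‖` modulo `|k ^ ×|`, for `x ∈ k' ^ ×`. -/
noncomputable def valueClass : k'ˣ →* ValueQuotient k k' :=
  (QuotientGroup.mk' _).comp (Units.map (normHom : k' →*₀ ℝ).toMonoidHom).rangeRestrict

theorem valueClass_surjective : Function.Surjective (valueClass k k') :=
  (QuotientGroup.mk'_surjective _).comp (MonoidHom.rangeRestrict_surjective _)

variable {k k'}

theorem valueClass_eq_one_iff {x : k'ˣ} :
    valueClass k k' x = 1 ↔ ∃ y : k, ‖(x : k')‖ = ‖y‖ := by
  refine (QuotientGroup.eq_one_iff _).trans (Subgroup.mem_subgroupOf.trans ⟨?_, ?_⟩)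
  · rintro ⟨y, hy⟩
    exact ⟨y, congrArg Units.val hy.symm⟩
  · rintro ⟨y, hy⟩
    have hy0 : y ≠ 0 := norm_ne_zero_iff.1 (hy ▸ norm_ne_zero_iff.2 x.ne_zero)
    exact ⟨Units.mk0 y hy0, Units.ext hy.symm⟩

theorem valueClass_eq_of_norm_eq {x x' : k'ˣ} {c : k} (h : ‖(x : k')‖ = ‖c‖ * ‖(x' : k')‖) :
    valueClass k k' x = valueClass k k' x' := by
  rw [← div_eq_one, ← map_div (valueClass k k'), valueClass_eq_one_iff]
  exact ⟨c, by simp [h]⟩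

variable [NormedAlgebra k k'] [FiniteDimensional k k']

theorem IsTotallyRamified.finite_valueQuotient (hram : IsTotallyRamified k k') :
    Finite (ValueQuotient k k') :=
  Nat.finite_of_card_ne_zero (hram.trans_ne finrank_pos.ne')

/-- Representatives of the cosets of `|k ^ ×|` are orthogonal, and there are `[k' : k]` of them. -/
theorem IsTotallyRamified.exists_basis_hasDistinctValues [IsUltrametricDist k']
    (hram : IsTotallyRamified k k') :
    ∃ B : Basis (Fin (finrank k k')) k k',
      (∃ i, B i = 1) ∧ HasDistinctValues (normSeminorm k k') B := by
  have := hram.finite_valueQuotient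
  let e : Fin (finrank k k') ≃ ValueQuotient k k' := (Finite.equivFinOfCardEq hram).symm
  let s := Function.surjInv (valueClass_surjective k k')
  have hs (q : ValueQuotient k k') : valueClass k k' (s q) = q := Function.surjInv_eq _ q
  let x (i : Fin (finrank k k')) : k'ˣ := s (e i) / s 1
  have hx : HasDistinctValues (normSeminorm k k') fun i => (x i : k') := by
    intro i j hij c hc
    have hclass : valueClass k k' (x i) = valueClass k k' (x j) := valueClass_eq_of_norm_eq hc
    simp only [x, map_div, hs, div_one] at hclass
    exact hij (e.injective hclass)
  have hli : LinearIndependent k fun i => (x i : k') :=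
    (hx.isOrthogonal IsUltrametricDist.norm_add_le_max).linearIndependent
      fun i => norm_ne_zero_iff.2 (x i).ne_zero
  have : Nonempty (Fin (finrank k k')) := ⟨e.symm 1⟩
  refine ⟨basisOfLinearIndependentOfCardEqFinrank hli (Fintype.card_fin _), ⟨e.symm 1, ?_⟩, ?_⟩
  · simp [x]
  · simpa using hx

/-- In an orthogonal basis containing `1`, the coordinate of `z` along `1` is the only one that can
contribute the value of `y`. -/
theorem IsTotallyRamified.exists_norm_sub_algebraMap_lt [IsUltrametricDist k']
    (hram : IsTotallyRamified k k') {z : k'} {y : k} (hz : z ≠ 0) (hzy : ‖z‖ = ‖y‖) :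
    ∃ t : k, ‖z - algebraMap k k' t‖ < ‖z‖ := by
  obtain ⟨B, ⟨i₀, hi₀⟩, hB⟩ := hram.exists_basis_hasDistinctValues
  have horth : IsOrthogonal (normSeminorm k k') B :=
    hB.isOrthogonal IsUltrametricDist.norm_add_le_max
  refine ⟨B.repr z i₀, ?_⟩
  have hsum : z - algebraMap k k' (B.repr z i₀) = ∑ i ∈ Finset.univ.erase i₀, B.repr z i • B i := by
    rw [Finset.sum_erase_eq_sub (Finset.mem_univ i₀), B.sum_repr, hi₀,
      Algebra.algebraMap_eq_smul_one]
  rw [hsum]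
  refine apply_sum_lt_of_forall_lt (N := normSeminorm k k') IsUltrametricDist.norm_add_le_max
    (norm_pos_iff.2 hz) fun i hi => ?_
  have hle : ‖B.repr z i‖ * ‖B i‖ ≤ ‖z‖ := by simpa [B.sum_repr] using horth (B.repr z) i
  rw [coe_normSeminorm, norm_smul]
  refine hle.lt_of_ne fun heq => ?_
  have hai : ‖B.repr z i‖ ≠ 0 := fun h0 => norm_ne_zero_iff.2 hz (by rw [← heq, h0, zero_mul])
  refine hB (Finset.ne_of_mem_erase hi) (y / B.repr z i) ?_
  rw [coe_normSeminorm, hi₀, norm_one, mul_one, norm_div, ← hzy, ← heq,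
    mul_div_cancel_left₀ _ hai]

theorem IsTotallyRamified.exists_norm_pow_prime_eq (hram : IsTotallyRamified k k') {p : ℕ}
    (hp : p.Prime) (hpd : p ∣ finrank k k') :
    ∃ x : k', (∀ y : k, ‖x‖ ≠ ‖y‖) ∧ ∃ y : k, ‖x ^ p‖ = ‖y‖ := by
  have := hram.finite_valueQuotient
  have : Fact p.Prime := ⟨hp⟩
  obtain ⟨q, hq⟩ := exists_prime_orderOf_dvd_card' p (hpd.trans (dvd_of_eq hram.symm))
  obtain ⟨x, rfl⟩ := valueClass_surjective k k' q
  refine ⟨x, fun y hy => ?_, ?_⟩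
  · rw [valueClass_eq_one_iff.2 ⟨y, hy⟩, orderOf_one] at hq
    exact hp.one_lt.ne hq
  · have hxp : valueClass k k' (x ^ p) = 1 := by rw [map_pow, ← hq, pow_orderOf_eq_one]
    simpa using valueClass_eq_one_iff.1 hxp

end Ramification

/-- The homothety class of a diagonalizable norm. -/
def DiagNorms.toBuilding {n : ℕ} {K : Type*} [NormedField K] (N : DiagNorms n K) : Building n K :=
  Quotient.mk _ N

section BaseChange

variable {n : ℕ} {k k' : Type*} [NormedField k] [NormedField k'] [NormedAlgebra k k']

/-- The restriction to `k ^ n` of a seminorm on `k' ^ n`. -/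
noncomputable def restrict (k : Type*) {k' : Type*} [NormedField k] [NormedField k']
    [NormedAlgebra k k'] (N : Seminorm k' (Fin n → k')) : Seminorm k (Fin n → k) :=
  (N.restrictScalars k).comp ((Algebra.linearMap k k').compLeft (Fin n))

theorem restrict_apply (N : Seminorm k' (Fin n → k')) (v : Fin n → k) :
    restrict k N v = N fun j => algebraMap k k' (v j) :=
  rfl

theorem isNonarchimedean_restrict {N : Seminorm k' (Fin n → k')} (hN : IsNonarchimedean N) :
    IsNonarchimedean (restrict k N) := by
  intro v w
  simp only [restrict, Seminorm.comp_apply, map_add]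
  exact hN _ _

theorem HasNormingFunctionals.restrict {N : Seminorm k' (Fin n → k')}
    (h : HasNormingFunctionals N) {ψ : k' →ₗ[k] k} (hψ1 : ψ 1 = 1) (hψ : ∀ z, ‖ψ z‖ ≤ ‖z‖) :
    HasNormingFunctionals (restrict k N) := by
  have hinj : Function.Injective ((Algebra.linearMap k k').compLeft (Fin n)) :=
    (algebraMap k k').injective.comp_left
  refine HasNormingFunctionals.comp (fun w hw => ?_) hinj
  obtain ⟨φ, hφw, hφ⟩ := h w hw
  exact ⟨ψ ∘ₗ φ.restrictScalars k, by simp [hφw, hψ1],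
    fun v => (mul_le_mul_of_nonneg_right (hψ _) (apply_nonneg _ _)).trans (hφ v)⟩

theorem IsDiagonalizable.restrict [IsUltrametricDist k'] {N : Seminorm k' (Fin n → k')}
    (hN : IsDiagonalizable N) {ψ : k' →ₗ[k] k} (hψ1 : ψ 1 = 1) (hψ : ∀ z, ‖ψ z‖ ≤ ‖z‖) :
    IsDiagonalizable (restrict k N) := by
  have hna : IsNonarchimedean (GoldmanIwahori.restrict k N) :=
    isNonarchimedean_restrict hN.add_le_max
  obtain ⟨b, hb⟩ := (hN.hasNormingFunctionals.restrict hψ1 hψ).exists_basis_isOrthogonal hna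
    (finrank_fin_fun k)
  refine hb.isDiagonalizable hna fun v hv => ?_
  exact (algebraMap k k').injective.comp_left (by simpa [funext_iff] using hN.eq_zero hv)

theorem le_tensorFun {N : Seminorm k (Fin n → k)} {M : Seminorm k' (Fin n → k')}
    (hM : IsNonarchimedean M) (hMN : restrict k M ≤ N) (w : Fin n → k') :
    M w ≤ tensorFun N w := by
  refine le_csInf ⟨_, n, w, fun i => Pi.single i 1, ?_, rfl⟩ ?_
  · ext j
    simp [Finset.sum_apply, Pi.single_apply, apply_ite (algebraMap k k')]
  · rintro _ ⟨m, a, x, rfl, rfl⟩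
    have hterm (i : Fin m) : M (a i • fun j => algebraMap k k' (x i j)) ≤ ‖a i‖ * N (x i) := by
      rw [map_smul_eq_mul]
      exact mul_le_mul_of_nonneg_left (hMN (x i)) (norm_nonneg _)
    exact apply_sum_le_of_forall_le hM (Real.iSup_nonneg fun i => by positivity) fun i _ =>
      (hterm i).trans (le_ciSup (f := fun i => ‖a i‖ * N (x i)) (Set.finite_range _).bddAbove i)

theorem tensorFun_sum_le {N : Seminorm k (Fin n → k)} {m : ℕ} {a : Fin m → k'}
    {x : Fin m → Fin n → k} {r : ℝ} (hr : 0 ≤ r) (h : ∀ i, ‖a i‖ * N (x i) ≤ r) :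
    tensorFun N (∑ i, a i • fun j => algebraMap k k' (x i j)) ≤ r := by
  have hbdd : BddBelow (tensorValues N (∑ i, a i • fun j => algebraMap k k' (x i j))) := by
    refine ⟨0, ?_⟩
    rintro _ ⟨m, a, x, -, rfl⟩
    exact Real.iSup_nonneg fun i => by positivity
  exact (csInf_le hbdd ⟨m, a, x, rfl, rfl⟩).trans (Real.iSup_le h hr)

variable [IsUltrametricDist k']

theorem restrict_baseChange (N : DiagNorms n k) : restrict k (N.baseChange k').1 = N.1 := by
  obtain ⟨b, c, h⟩ := N.2
  ext v
  rw [restrict_apply]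
  refine (tensorFun_eq h _).trans ?_
  simp only [h, diagFun, extendBasis_repr, norm_algebraMap']

theorem baseChange_injective : Function.Injective (Building.baseChange n k k') := by
  rintro ⟨N⟩ ⟨N'⟩ hNN
  obtain ⟨a, ha, h⟩ := Quotient.exact hNN
  refine Quotient.sound ⟨a, ha, fun v => ?_⟩
  rw [← restrict_baseChange (k' := k') N, ← restrict_baseChange (k' := k') N']
  exact h _

theorem toBuilding_mem_range_baseChange {N : DiagNorms n k'}
    (hN : IsDiagonalizable (restrict k N.1)) (h : ∀ w, tensorFun (restrict k N.1) w = N.1 w) :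
    N.toBuilding ∈ Set.range (Building.baseChange n k k') :=
  ⟨DiagNorms.toBuilding ⟨restrict k N.1, hN⟩,
    Quotient.sound ⟨1, one_pos, fun w => (h w).trans (one_mul _).symm⟩⟩

theorem tensorFun_restrict_of_mem_range_baseChange {N : DiagNorms n k'}
    (h : N.toBuilding ∈ Set.range (Building.baseChange n k k')) (w : Fin n → k') :
    tensorFun (restrict k N.1) w = N.1 w := by
  obtain ⟨⟨N'⟩, hN'⟩ := h
  obtain ⟨a, ha, hNa⟩ := Quotient.exact hN'
  have hrestrict (v : Fin n → k) : N'.1 v = a * restrict k N.1 v := by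
    rw [← restrict_baseChange (k' := k') N']
    exact hNa _
  refine mul_left_cancel₀ ha.ne' ?_
  rw [← tensorFun_homothety ha hrestrict w]
  exact hNa w

end BaseChange

section GaloisInvariance

variable {n : ℕ} {k k' : Type*} [NontriviallyNormedField k] [NormedField k'] [NormedAlgebra k k']

variable (k) in
/-- Invariance of a seminorm on `k' ^ n` under the coordinatewise action of `Gal(k'/k)`. -/
def IsGaloisInvariant (N : Seminorm k' (Fin n → k')) : Prop :=
  ∀ (σ : k' ≃ₐ[k] k') (v : Fin n → k'), N (fun j => σ (v j)) = N v

theorem isGaloisInvariant_of_le {N : Seminorm k' (Fin n → k')}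
    (h : ∀ (σ : k' ≃ₐ[k] k') (v : Fin n → k'), N (fun j => σ (v j)) ≤ N v) :
    IsGaloisInvariant k N :=
  fun σ v => (h σ v).antisymm (by simpa using h σ.symm fun j => σ (v j))

variable [CompleteSpace k] [IsUltrametricDist k] [FiniteDimensional k k']

theorem galois_smul_toBuilding (σ : k' ≃ₐ[k] k') (N : DiagNorms n k') :
    σ • N.toBuilding = (N.galois σ).toBuilding :=
  rfl

/-- Automorphisms have finite order, so the homothety factor of `σ` on a fixed class is a root of
unity in `ℝ_{> 0}`. -/
theorem toBuilding_mem_fixedPoints_iff {N : DiagNorms n k'} :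
    N.toBuilding ∈ MulAction.fixedPoints (k' ≃ₐ[k] k') (Building n k') ↔
      IsGaloisInvariant k N.1 := by
  refine ⟨fun h σ v => ?_, fun h σ => Quotient.sound
    ⟨1, one_pos, fun v => (h σ.symm v).trans (one_mul _).symm⟩⟩
  obtain ⟨a, ha, hNa⟩ := Quotient.exact ((galois_smul_toBuilding σ⁻¹ N).symm.trans (h σ⁻¹))
  have hσ (w : Fin n → k') : N.1 (fun j => σ (w j)) = a * N.1 w := hNa w
  have hpow (m : ℕ) : N.1 (fun j => (σ ^ m) (v j)) = a ^ m * N.1 v := by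
    induction m with
    | zero => simp
    | succ m ih => simp only [pow_succ', AlgEquiv.mul_apply, hσ, ih, mul_assoc]
  have horder : N.1 v = a ^ orderOf σ * N.1 v := by
    simpa only [pow_orderOf_eq_one, AlgEquiv.one_apply] using hpow (orderOf σ)
  rcases eq_or_ne (N.1 v) 0 with hv | hv
  · rw [hσ, hv, mul_zero]
  · have ha1 : a = 1 :=
      (pow_eq_one_iff_of_nonneg ha.le (orderOf_pos σ).ne').1 ((right_eq_mul₀ hv).1 horder)
    rw [hσ, ha1, one_mul]

theorem range_baseChange_subset_fixedPoints [IsUltrametricDist k'] :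
    Set.range (Building.baseChange n k k') ⊆
      MulAction.fixedPoints (k' ≃ₐ[k] k') (Building n k') := by
  rintro _ ⟨⟨N⟩, rfl⟩
  refine toBuilding_mem_fixedPoints_iff.2 fun σ w => ?_
  obtain ⟨b, c, h⟩ := N.2
  refine (tensorFun_eq h _).trans (Eq.trans ?_ (tensorFun_eq h _).symm)
  have hw : (fun j => σ (w j)) = ∑ i, σ ((extendBasis k' b).repr w i) • extendBasis k' b i := by
    ext j
    conv_lhs => rw [← (extendBasis k' b).sum_repr w]
    simp [extendBasis_apply, Finset.sum_apply]
  simp only [diagFun, hw, Basis.repr_sum_self, norm_galois]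

end GaloisInvariance

section Tame

variable {n : ℕ} {k k' : Type*} [NontriviallyNormedField k] [NormedField k'] [NormedAlgebra k k']

variable (k k') in
/-- The trace of `k'/k` divided by the degree, a retraction of `k'` onto `k` if the degree is prime
to the characteristic of `k`. (`Algebra.normalizedTrace` requires characteristic zero.) -/
noncomputable def normalizedTrace : k' →ₗ[k] k :=
  (finrank k k' : k)⁻¹ • Algebra.trace k k'

theorem normalizedTrace_one (hd : ‖(finrank k k' : k)‖ = 1) : normalizedTrace k k' 1 = 1 := by
  have hd0 : (finrank k k' : k) ≠ 0 := norm_ne_zero_iff.1 (hd ▸ one_ne_zero)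
  have htrace : Algebra.trace k k' 1 = finrank k k' := by
    simpa using Algebra.trace_algebraMap (S := k') (1 : k)
  rw [normalizedTrace, LinearMap.smul_apply, htrace, smul_eq_mul, inv_mul_cancel₀ hd0]

variable [FiniteDimensional k k'] [IsGalois k k']

theorem norm_normalizedTrace_le [CompleteSpace k] [IsUltrametricDist k] [IsUltrametricDist k']
    (hd : ‖(finrank k k' : k)‖ = 1) (z : k') : ‖normalizedTrace k k' z‖ ≤ ‖z‖ := by
  rw [normalizedTrace, LinearMap.smul_apply, norm_smul, norm_inv, hd, inv_one, one_mul,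
    ← norm_algebraMap' k', trace_eq_sum_automorphisms]
  exact IsUltrametricDist.norm_sum_le_of_forall_le_of_nonneg (norm_nonneg _)
    fun σ _ => (norm_galois σ z).le

variable {N : Seminorm k' (Fin n → k')}

theorem restrict_normalizedTrace_le (hd : ‖(finrank k k' : k)‖ = 1) (hN : IsNonarchimedean N)
    (hinv : IsGaloisInvariant k N) (w : Fin n → k') :
    restrict k N (fun j => normalizedTrace k k' (w j)) ≤ N w := by
  have hsum : (fun j => algebraMap k k' (Algebra.trace k k' (w j))) =
      ∑ σ : k' ≃ₐ[k] k', fun j => σ (w j) := by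
    ext j
    rw [trace_eq_sum_automorphisms, Finset.sum_apply]
  calc restrict k N (fun j => normalizedTrace k k' (w j))
      = ‖(finrank k k' : k)⁻¹‖ * restrict k N (fun j => Algebra.trace k k' (w j)) :=
        map_smul_eq_mul (restrict k N) _ _
    _ = N (∑ σ : k' ≃ₐ[k] k', fun j => σ (w j)) := by
        rw [norm_inv, hd, inv_one, one_mul, restrict_apply, hsum]
    _ ≤ N w := apply_sum_le_of_forall_le hN (apply_nonneg _ _) fun σ _ => (hinv σ w).le

variable [CompleteSpace k] [IsUltrametricDist k] [IsUltrametricDist k']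

theorem norm_normalizedTrace_inv_mul_lt {ι : Type*} {B : ι → k'}
    (hd : ‖(finrank k k' : k)‖ = 1) (hB : HasDistinctValues (normSeminorm k k') B) {i j : ι}
    (hij : i ≠ j) (hj : B j ≠ 0) : ‖normalizedTrace k k' ((B j)⁻¹ * B i)‖ < ‖(B j)⁻¹ * B i‖ := by
  refine (norm_normalizedTrace_le hd _).lt_of_ne fun heq =>
    hB hij (normalizedTrace k k' ((B j)⁻¹ * B i)) ?_
  rw [heq, norm_mul, norm_inv, mul_comm, coe_normSeminorm,
    mul_inv_cancel_left₀ (norm_ne_zero_iff.2 hj)]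

/-- If `‖B l‖ * restrict k N (x l)` is maximal and `w` denotes the sum, then the normalized trace of
`(B l)⁻¹ • w` is `x l` up to strictly smaller terms. -/
theorem mul_restrict_le_apply_sum {ι : Type*} [Fintype ι] {B : ι → k'}
    (hd : ‖(finrank k k' : k)‖ = 1) (hB : HasDistinctValues (normSeminorm k k') B)
    (hB0 : ∀ i, B i ≠ 0) (hN : IsNonarchimedean N) (hinv : IsGaloisInvariant k N)
    (x : ι → Fin n → k) (i : ι) :
    ‖B i‖ * restrict k N (x i) ≤ N (∑ j, B j • fun m => algebraMap k k' (x j m)) := by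
  have : Nonempty ι := ⟨i⟩
  obtain ⟨l, hl⟩ := Finite.exists_max fun j => ‖B j‖ * restrict k N (x j)
  refine (hl i).trans ?_
  set w := ∑ j, B j • fun m => algebraMap k k' (x j m) with hw
  have hBl : 0 < ‖B l‖ := norm_pos_iff.2 (hB0 l)
  rcases (apply_nonneg (restrict k N) (x l)).eq_or_lt with hxl | hxl
  · simp [← hxl]
  let t (j : ι) : Fin n → k := normalizedTrace k k' ((B l)⁻¹ * B j) • x j
  have htrace : (fun m => normalizedTrace k k' (((B l)⁻¹ • w) m)) = ∑ j, t j := by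
    ext m
    simp only [hw, Pi.smul_apply, Finset.sum_apply, smul_eq_mul, Finset.mul_sum, map_sum, t]
    refine Finset.sum_congr rfl fun j _ => ?_
    rw [← mul_assoc, ← Algebra.commutes, ← Algebra.smul_def, map_smul, smul_eq_mul, mul_comm]
  have htl : t l = x l := by
    simp only [t, inv_mul_cancel₀ (hB0 l), normalizedTrace_one hd, one_smul]
  have hsmall (j : ι) (hj : j ≠ l) : restrict k N (t j) < restrict k N (t l) := by
    rw [htl, map_smul_eq_mul]
    rcases (apply_nonneg (restrict k N) (x j)).eq_or_lt with hxj | hxj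
    · rwa [← hxj, mul_zero]
    · refine (mul_lt_mul_of_pos_right
        (norm_normalizedTrace_inv_mul_lt hd hB hj (hB0 l)) hxj).trans_le ?_
      rw [norm_mul, norm_inv, mul_assoc, inv_mul_le_iff₀ hBl]
      exact hl j
  have hdominant : restrict k N (∑ j, t j) = restrict k N (x l) :=
    htl ▸ (isNonarchimedean_restrict hN).apply_sum_eq_of_lt
      (fun v => (map_neg_eq_map (restrict k N) v).symm) (Finset.mem_univ l) fun j _ => hsmall j
  rw [← hdominant, ← htrace, ← le_inv_mul_iff₀ hBl, ← norm_inv, ← map_smul_eq_mul]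
  exact restrict_normalizedTrace_le hd hN hinv _

theorem fixedPoints_subset_range_baseChange (hram : IsTotallyRamified k k')
    (hd : ‖(finrank k k' : k)‖ = 1) :
    MulAction.fixedPoints (k' ≃ₐ[k] k') (Building n k') ⊆
      Set.range (Building.baseChange n k k') := by
  rintro ⟨N⟩ hfixed
  have hinv : IsGaloisInvariant k N.1 := toBuilding_mem_fixedPoints_iff.1 hfixed
  obtain ⟨B, -, hB⟩ := hram.exists_basis_hasDistinctValues
  have hna : IsNonarchimedean N.1 := N.2.add_le_max
  refine toBuilding_mem_range_baseChange
    (N.2.restrict (normalizedTrace_one hd) (norm_normalizedTrace_le hd))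
    fun w => le_antisymm ?_ (le_tensorFun hna le_rfl w)
  have hw : w = ∑ i, B i • fun j => algebraMap k k' (B.repr (w j) i) := by
    ext j
    conv_lhs => rw [← B.sum_repr (w j)]
    simp [Finset.sum_apply, Algebra.smul_def, mul_comm]
  rw [hw]
  exact tensorFun_sum_le (apply_nonneg _ _) (mul_restrict_le_apply_sum hd hB B.ne_zero hna hinv _)

end Tame

section WildRamification

variable {k k' : Type*} [NontriviallyNormedField k] [NormedField k'] [IsUltrametricDist k']
  [NormedAlgebra k k']

theorem norm_algebraMap_mul_le_norm_sub {x : k'} (hx : ∀ y : k, ‖x‖ ≠ ‖y‖) (a b : k) :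
    ‖x * algebraMap k k' b‖ ≤ ‖algebraMap k k' a - x * algebraMap k k' b‖ := by
  rcases eq_or_ne b 0 with rfl | hb
  · simp
  · have hne : ‖algebraMap k k' a‖ ≠ ‖-(x * algebraMap k k' b)‖ := fun heq => hx (a / b) <| by
      rw [norm_neg, norm_mul, norm_algebraMap', norm_algebraMap'] at heq
      rw [norm_div, heq, mul_div_cancel_right₀ _ (norm_ne_zero_iff.2 hb)]
    rw [sub_eq_add_neg, IsUltrametricDist.norm_add_eq_max_of_norm_ne_norm hne, norm_neg]
    exact le_max_right _ _

variable [CompleteSpace k] [IsUltrametricDist k]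

/-- If `‖x‖` has order `p` modulo `|k ^ ×|`, then `x ^ p` is `t ∈ k ^ ×` up to a principal unit, so
that `(σ x / x) ^ p` is a principal unit, and then so is `σ x / x` in residue characteristic `p`. -/
theorem IsTotallyRamified.exists_norm_galois_sub_lt [FiniteDimensional k k']
    (hram : IsTotallyRamified k k') (hdvd : residueChar k ∣ finrank k k') :
    ∃ x : k', (∀ y : k, ‖x‖ ≠ ‖y‖) ∧ ∀ σ : k' ≃ₐ[k] k', ‖σ x - x‖ < ‖x‖ := by
  have hp : (residueChar k).Prime := residueChar_prime finrank_pos.ne' hdvd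
  obtain ⟨x, hx, y, hy⟩ := hram.exists_norm_pow_prime_eq hp hdvd
  have hx0 : x ≠ 0 := fun h => hx 0 (by simp [h])
  obtain ⟨t, ht⟩ := hram.exists_norm_sub_algebraMap_lt (pow_ne_zero _ hx0) hy
  refine ⟨x, hx, fun σ => ?_⟩
  set p := residueChar k
  have hpow : ‖(σ x) ^ p - x ^ p‖ < ‖x ^ p‖ := by
    have hσt : ‖σ x ^ p - algebraMap k k' t‖ < ‖x ^ p‖ := by
      rwa [← map_pow, ← σ.commutes t, ← map_sub, norm_galois]
    rw [← sub_add_sub_cancel _ (algebraMap k k' t)]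
    exact (IsUltrametricDist.norm_add_le_max _ _).trans_lt (max_lt hσt (by rwa [norm_sub_rev]))
  have hunit : ‖(σ x / x) ^ p - 1‖ < 1 := by
    rwa [div_pow, div_sub_one (pow_ne_zero p hx0), norm_div,
      div_lt_one (norm_pos_iff.2 (pow_ne_zero p hx0))]
  have hroot := norm_sub_one_lt_one_of_pow hp (residueChar_eq k k') hunit
  rwa [div_sub_one hx0, norm_div, div_lt_one (norm_pos_iff.2 hx0)] at hroot

end WildRamification

section ShearNorm

variable {n : ℕ} {K : Type*} [NormedField K] {i j : Fin n} (hij : i ≠ j) (x : K)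

/-- The basis of `K ^ n` obtained from the standard one by adding `x` times the vector at `i` to the
vector at `j`. -/
noncomputable def shearBasis : Basis (Fin n) K (Fin n → K) :=
  Basis.ofEquivFun (LinearEquiv.transvection (f := LinearMap.proj j) (v := Pi.single i (-x))
    (by simp [hij.symm]))

theorem shearBasis_repr (v : Fin n → K) (l : Fin n) :
    (shearBasis hij x).repr v l = v l - if l = i then x * v j else 0 := by
  rw [← Basis.equivFun_apply, shearBasis, Basis.equivFun_ofEquivFun]
  simp [LinearMap.transvection.apply, Pi.single_apply, sub_eq_add_neg, mul_comm, neg_ite]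

theorem shearBasis_apply_right : shearBasis hij x j = Pi.single i x + Pi.single j 1 := by
  refine (shearBasis hij x).repr.injective (Finsupp.ext fun l => ?_)
  rw [Basis.repr_self, Finsupp.single_apply, shearBasis_repr]
  by_cases hli : l = i <;> by_cases hlj : l = j <;>
    simp_all [Pi.single_apply, eq_comm]

variable [IsUltrametricDist K] (r : ℝ)

/-- The diagonal norm `v ↦ max (‖v i - x * v j‖, r * ‖v j‖, ‖v l‖)`, where `l` runs over the indices
other than `i` and `j`, for `r > 0`. -/
noncomputable def shearNorm : DiagNorms n K :=
  ⟨diagSeminorm (shearBasis hij x) (Pi.single j (Real.log r)), _, _, fun _ => rfl⟩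

theorem shearNorm_apply (v : Fin n → K) :
    (shearNorm hij x r).1 v = diagFun (shearBasis hij x) (Pi.single j (Real.log r)) v :=
  rfl

variable {r} (hr : 0 < r)

theorem norm_sub_mul_le_shearNorm (v : Fin n → K) :
    ‖v i - x * v j‖ ≤ (shearNorm hij x r).1 v := by
  simpa [shearNorm_apply, shearBasis_repr, hij] using
    le_diagFun (shearBasis hij x) (Pi.single j (Real.log r)) v i

theorem norm_le_shearNorm (v : Fin n → K) {l : Fin n} (hli : l ≠ i) (hlj : l ≠ j) :
    ‖v l‖ ≤ (shearNorm hij x r).1 v := by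
  simpa [shearNorm_apply, shearBasis_repr, hli, hlj] using
    le_diagFun (shearBasis hij x) (Pi.single j (Real.log r)) v l

include hr

theorem mul_norm_le_shearNorm (v : Fin n → K) : r * ‖v j‖ ≤ (shearNorm hij x r).1 v := by
  simpa [shearNorm_apply, shearBasis_repr, hij.symm, Real.exp_log hr] using
    le_diagFun (shearBasis hij x) (Pi.single j (Real.log r)) v j

theorem shearNorm_le {v : Fin n → K} {s : ℝ} (hi : ‖v i - x * v j‖ ≤ s) (hj : r * ‖v j‖ ≤ s)
    (hl : ∀ l, l ≠ i → l ≠ j → ‖v l‖ ≤ s) : (shearNorm hij x r).1 v ≤ s := by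
  refine diagFun_le ((norm_nonneg _).trans hi) fun l => ?_
  rw [shearBasis_repr]
  rcases eq_or_ne l j with rfl | hlj
  · simpa [hij.symm, Real.exp_log hr] using hj
  rcases eq_or_ne l i with rfl | hli
  · simpa [hij] using hi
  · simpa [hli, hlj] using hl l hli hlj

theorem shearNorm_shearBasis : (shearNorm hij x r).1 (shearBasis hij x j) = r := by
  refine (diagFun_basis _ _ j).trans ?_
  rw [Pi.single_eq_same, Real.exp_log hr]

end ShearNorm

section WildBuilding

variable {n : ℕ} {k k' : Type*} [NontriviallyNormedField k] [NormedField k'] [IsUltrametricDist k']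
  [NormedAlgebra k k'] {i j : Fin n} (hij : i ≠ j) {x : k'} {r : ℝ}

/-- On `k ^ n` the seminorm `v ↦ ‖x * v j‖` is dominated by the sheared norm, since `‖x‖` is not a
value of `k`, whereas on `k' ^ n` it is not. -/
theorem shearNorm_toBuilding_notMem_range_baseChange (hr : 0 < r) (hrx : r < ‖x‖)
    (hx : ∀ y : k, ‖x‖ ≠ ‖y‖) :
    (shearNorm hij x r).toBuilding ∉ Set.range (Building.baseChange n k k') := by
  intro hmem
  let M : Seminorm k' (Fin n → k') := (normSeminorm k' k').comp (x • LinearMap.proj j)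
  have hM : IsNonarchimedean M := fun v w => by
    simp only [M, Seminorm.comp_apply, map_add, coe_normSeminorm]
    exact IsUltrametricDist.norm_add_le_max _ _
  have hMN : restrict k M ≤ restrict k (shearNorm hij x r).1 := fun v =>
    (norm_algebraMap_mul_le_norm_sub hx (v i) (v j)).trans
      (norm_sub_mul_le_shearNorm hij x fun l => algebraMap k k' (v l))
  have hle := le_tensorFun hM hMN (shearBasis hij x j)
  rw [tensorFun_restrict_of_mem_range_baseChange hmem, shearNorm_shearBasis hij x hr] at hle
  refine hrx.not_ge (le_of_eq_of_le ?_ hle)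
  simp [M, shearBasis_apply_right, hij.symm]

variable [CompleteSpace k] [IsUltrametricDist k] [FiniteDimensional k k']

theorem isGaloisInvariant_shearNorm (hr : 0 < r) (hσ : ∀ σ : k' ≃ₐ[k] k', ‖σ x - x‖ ≤ r) :
    IsGaloisInvariant k (shearNorm hij x r).1 := by
  refine isGaloisInvariant_of_le fun σ v => shearNorm_le hij x hr ?_ ?_ fun l hli hlj => ?_
  · have hsplit : σ (v i) - x * σ (v j) = σ (v i - x * v j) + (σ x - x) * σ (v j) := by
      rw [map_sub, map_mul]
      ring
    rw [hsplit]
    refine (IsUltrametricDist.norm_add_le_max _ _).trans (max_le ?_ ?_)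
    · exact (norm_galois σ _).trans_le (norm_sub_mul_le_shearNorm hij x v)
    · rw [norm_mul, norm_galois]
      exact (mul_le_mul_of_nonneg_right (hσ σ) (norm_nonneg _)).trans
        (mul_norm_le_shearNorm hij x hr v)
  · exact (norm_galois σ (v j)).symm ▸ mul_norm_le_shearNorm hij x hr v
  · exact (norm_galois σ (v l)).trans_le (norm_le_shearNorm hij x v hli hlj)

theorem exists_mem_fixedPoints_notMem_range_baseChange (hij : i ≠ j)
    (hram : IsTotallyRamified k k') (hdvd : residueChar k ∣ finrank k k') :
    ∃ P ∈ MulAction.fixedPoints (k' ≃ₐ[k] k') (Building n k'),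
      P ∉ Set.range (Building.baseChange n k k') := by
  obtain ⟨x, hx, hσx⟩ := hram.exists_norm_galois_sub_lt hdvd
  obtain ⟨τ, hτ⟩ := Finite.exists_max fun σ : k' ≃ₐ[k] k' => ‖σ x - x‖
  obtain ⟨r, hτr, hrx⟩ := exists_between (hσx τ)
  have hr : 0 < r := (norm_nonneg _).trans_lt hτr
  exact ⟨(shearNorm hij x r).toBuilding, toBuilding_mem_fixedPoints_iff.2
      (isGaloisInvariant_shearNorm hij hr fun σ => (hτ σ).trans hτr.le),
    shearNorm_toBuilding_notMem_range_baseChange hij hr hrx hx⟩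

end WildBuilding

end GoldmanIwahori

theorem mainTheorem8_general (k k' : Type*)
    [NontriviallyNormedField k] [CompleteSpace k] [IsUltrametricDist k]
    [NormedField k'] [IsUltrametricDist k'] [NormedAlgebra k k']
    [FiniteDimensional k k'] [IsGalois k k'] {n : ℕ} (hn : 2 ≤ n)
    (hram : GoldmanIwahori.IsTotallyRamified k k') :
    Function.Injective (GoldmanIwahori.Building.baseChange n k k') ∧
    Set.range (GoldmanIwahori.Building.baseChange n k k') ⊆
      MulAction.fixedPoints (k' ≃ₐ[k] k') (GoldmanIwahori.Building n k') ∧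
    (Set.range (GoldmanIwahori.Building.baseChange n k k') ⊂
        MulAction.fixedPoints (k' ≃ₐ[k] k') (GoldmanIwahori.Building n k') ↔
      GoldmanIwahori.residueChar k ∣ Module.finrank k k') := by
  have hsub := GoldmanIwahori.range_baseChange_subset_fixedPoints (n := n) (k := k) (k' := k')
  refine ⟨GoldmanIwahori.baseChange_injective, hsub, fun hss => ?_, fun hdvd => ?_⟩
  · by_contra hndvd
    exact hss.2 (GoldmanIwahori.fixedPoints_subset_range_baseChange hram
      (GoldmanIwahori.norm_natCast_eq_one hndvd))
  · have hij : (⟨0, by omega⟩ : Fin n) ≠ ⟨1, hn⟩ := by simp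
    obtain ⟨P, hP, hPr⟩ :=
      GoldmanIwahori.exists_mem_fixedPoints_notMem_range_baseChange hij hram hdvd
    exact ⟨hsub, fun hsup => hPr (hsup hP)⟩

theorem mainTheorem8 (k k' : Type*)
    [NontriviallyNormedField k] [CompleteSpace k] [IsUltrametricDist k]
    [NormedField k'] [IsUltrametricDist k'] [NormedAlgebra k k']
    [FiniteDimensional k k'] [IsGalois k k']
    (hdisc : GoldmanIwahori.IsDiscretelyValued k)
    (hram : GoldmanIwahori.IsTotallyRamified k k') :
    Function.Injective (GoldmanIwahori.Building.baseChange 2 k k') ∧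
    Set.range (GoldmanIwahori.Building.baseChange 2 k k') ⊆
      MulAction.fixedPoints (k' ≃ₐ[k] k') (GoldmanIwahori.Building 2 k') ∧
    (Set.range (GoldmanIwahori.Building.baseChange 2 k k') ⊂
        MulAction.fixedPoints (k' ≃ₐ[k] k') (GoldmanIwahori.Building 2 k') ↔
      GoldmanIwahori.residueChar k ∣ Module.finrank k k') :=
  mainTheorem8_general k k' le_rfl hram
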